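/- Let $n\ge 0$ be an integer and let $k\in\{1,2,3,\dots\}\cup\{\infty\}$. For a local commutative principal ideal ring $A$ with maximal ideal $\wp$ and residue field $\mathbf k=A/\wp$, the length of $A$ is the least $m$ such that $\wp^m=0$, or $\infty$ if there is no such $m$. Let $B=B(A)$ be the subgroup of upper triangular matrices in $GL_n(A)$, and let $|B\backslash GL_n(A)/B|$ be the number of double cosets, as a cardinal number. **Theorem.** The number $|B\backslash GL_n(A)/B|$ does not depend on the residue field of $A$, in the sense that $|B(A)\backslash GL_n(A)/B(A)|=|B(A')\backslash GL_n(A')/B(A')|$ for any two local principal ideal rings $A,A'$ of length $k$ (with arbitrary residue fields), if and only if $n\le 2$ or $k=1$ or $(n,k)=(3,2)$. Moreover, in all other cases there are two local principal ideal rings $A,A'$ of length $k$, with residue fields of different cardinalities (both finite if $k$ is finite), such that $|B(A)\backslash GL_n(A)/B(A)|\ne|B(A')\backslash GL_n(A')/B(A')|$. -/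

import Mathlib

universe u

namespace LocalPIR

/-- The length of a local ring: the least `k` such that the `k`-th power of the maximal ideal is
zero, and `⊤` if there is no such `k`. -/
noncomputable def ringLength (A : Type u) [CommRing A] [IsLocalRing A] : ℕ∞ :=
  ⨅ (m : ℕ) (_ : IsLocalRing.maximalIdeal A ^ m = ⊥), (m : ℕ∞)

/-- The subgroup `B` of upper triangular matrices in `GL_n(A)`. -/
def upperTriangular (n : ℕ) (A : Type u) [CommRing A] : Subgroup (GL (Fin n) A) where
  carrier := {g | ∀ i j : Fin n, j < i → (g : Matrix (Fin n) (Fin n) A) i j = 0}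
  one_mem' := fun i j h => by
    simpa using Matrix.one_apply_ne (α := A) h.ne'
  mul_mem' := fun {a b} ha hb i j h => by
    have ha' : Matrix.BlockTriangular (a : Matrix (Fin n) (Fin n) A) id := fun i j h => ha i j h
    have hb' : Matrix.BlockTriangular (b : Matrix (Fin n) (Fin n) A) id := fun i j h => hb i j h
    exact (ha'.mul hb') h
  inv_mem' := fun {a} ha i j h => by
    have ha' : Matrix.BlockTriangular (a : Matrix (Fin n) (Fin n) A) id := fun i j h => ha i j h
    have := a.invertible
    have := Matrix.blockTriangular_inv_of_blockTriangular ha'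
    rw [Matrix.coe_units_inv]
    exact this h

/-- The number of double cosets in `B \ GL_n(A) / B`, as a cardinal. -/
noncomputable def numDoubleCosets (n : ℕ) (A : Type u) [CommRing A] : Cardinal.{u} :=
  Cardinal.mk (DoubleCoset.Quotient (upperTriangular n A : Set (GL (Fin n) A))
    (upperTriangular n A : Set (GL (Fin n) A)))

/-- Any two local principal ideal rings of length `k`, whatever their residue fields, have the same
number of double cosets in `B \ GL_n / B`. -/
def Independent (n : ℕ) (k : ℕ∞) : Prop :=
  ∀ (A A' : Type u) [CommRing A] [IsLocalRing A] [IsPrincipalIdealRing A]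
    [CommRing A'] [IsLocalRing A'] [IsPrincipalIdealRing A'],
    ringLength A = k → ringLength A' = k → numDoubleCosets n A = numDoubleCosets n A'

/-- There are two local principal ideal rings of length `k`, with residue fields of different
cardinalities (both finite when `k` is finite), whose numbers of double cosets in
`B \ GL_n / B` are different. -/
def DependsOnResidueField (n : ℕ) (k : ℕ∞) : Prop :=
  ∃ (A A' : Type u) (_ : CommRing A) (_ : IsLocalRing A) (_ : IsPrincipalIdealRing A)
    (_ : CommRing A') (_ : IsLocalRing A') (_ : IsPrincipalIdealRing A'),
    ringLength A = k ∧ ringLength A' = k ∧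
    Cardinal.mk (IsLocalRing.ResidueField A) ≠ Cardinal.mk (IsLocalRing.ResidueField A') ∧
    (k ≠ ⊤ → Finite (IsLocalRing.ResidueField A) ∧ Finite (IsLocalRing.ResidueField A')) ∧
    numDoubleCosets n A ≠ numDoubleCosets n A'

end LocalPIR

/-! Dependence follows from the bound that the residue field is no larger than the set of double
cosets whenever `n ≥ 3`, the length is at least 2 and `(n, k) ≠ (3, 2)`. The bound comes from
one-parameter families whose parameter modulo the maximal ideal `(t)` is an invariant: lower
unitriangular matrices of size 3 with entries `t, t, t²e` when `t² ≠ 0`, and matrices of size 4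
carrying a cross-ratio `e` when only `t ≠ 0`. Block sums with an identity carry the bound to larger
`n`. For any `A` of length `k` with finitely many cosets if `k` is finite, choosing `A'` with
residue field larger than the coset set of `A` makes both the residue fields and the counts differ.

Independence is by explicit counts. For `n ≤ 1` there is one coset. For `n = 2` cosets correspond to
ideals of `A`, hence to exponents determined by the length. For `k = 1` the ring is a field and
Bruhat decomposition gives the permutations. For `(3, 2)` every coset contains a lower unitriangular
matrix; diagonal scalings and one row or column operation remove all unit parameters, leaving 18
representatives, which the ideals generated by minors of lower left blocks separate. -/

namespace LocalPIR

open IsLocalRing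

/-! ### Double cosets as solutions of matrix equations -/

section Cosets

variable {n : ℕ} {A : Type u} [CommRing A]

/-- The double coset in `B \ GL_n(A) / B` of an invertible matrix. -/
abbrev coset (g : GL (Fin n) A) :
    DoubleCoset.Quotient (upperTriangular n A : Set (GL (Fin n) A))
      (upperTriangular n A : Set (GL (Fin n) A)) :=
  DoubleCoset.mk (upperTriangular n A) (upperTriangular n A) g

theorem coset_surjective (q : DoubleCoset.Quotient (upperTriangular n A : Set (GL (Fin n) A))
    (upperTriangular n A : Set (GL (Fin n) A))) : ∃ g, coset g = q :=
  ⟨q.out, DoubleCoset.out_eq' _ _ q⟩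

/-- An upper triangular matrix with invertible diagonal entries. -/
structure IsUpper (M : Matrix (Fin n) (Fin n) A) : Prop where
  lower_eq_zero : ∀ i j : Fin n, j < i → M i j = 0
  isUnit_diag : ∀ i, IsUnit (M i i)

theorem isUpper_iff_exists (M : Matrix (Fin n) (Fin n) A) :
    IsUpper M ↔ ∃ b ∈ upperTriangular n A, (b : Matrix (Fin n) (Fin n) A) = M := by
  constructor
  · rintro ⟨h, hd⟩
    have hM : M.BlockTriangular id := fun i j h' => h i j h'
    have hu : IsUnit M := by
      rw [Matrix.isUnit_iff_isUnit_det, Matrix.det_of_isUpperTriangular hM]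
      exact IsUnit.prod_univ_iff.2 hd
    exact ⟨hu.unit, h, rfl⟩
  · rintro ⟨b, hb, rfl⟩
    refine ⟨hb, IsUnit.prod_univ_iff.1 ?_⟩
    have hM : (b : Matrix (Fin n) (Fin n) A).BlockTriangular id := fun i j h' => hb i j h'
    rw [← Matrix.det_of_isUpperTriangular hM]
    exact (Matrix.isUnit_iff_isUnit_det _).1 b.isUnit

theorem isUpper_one : IsUpper (1 : Matrix (Fin n) (Fin n) A) :=
  (isUpper_iff_exists _).2 ⟨1, one_mem _, rfl⟩

/-- Moving one factor across avoids inverses, so each matrix entry gives an equation linear in the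
entries of `P` and `Q`. -/
theorem coset_eq_iff (g h : GL (Fin n) A) :
    coset g = coset h ↔ ∃ P Q : Matrix (Fin n) (Fin n) A, IsUpper P ∧ IsUpper Q ∧
      P * (g : Matrix (Fin n) (Fin n) A) = (h : Matrix (Fin n) (Fin n) A) * Q := by
  rw [DoubleCoset.eq]
  constructor
  · rintro ⟨b, hb, b', hb', rfl⟩
    refine ⟨b, (b'⁻¹ : GL (Fin n) A), (isUpper_iff_exists _).2 ⟨b, hb, rfl⟩,
      (isUpper_iff_exists _).2 ⟨b'⁻¹, inv_mem hb', rfl⟩, ?_⟩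
    simp only [← Units.val_mul, mul_assoc, mul_inv_cancel, mul_one]
  · rintro ⟨P, Q, hP, hQ, h'⟩
    obtain ⟨b, hb, rfl⟩ := (isUpper_iff_exists _).1 hP
    obtain ⟨b', hb', rfl⟩ := (isUpper_iff_exists _).1 hQ
    refine ⟨b, hb, b'⁻¹, inv_mem hb', ?_⟩
    rw [← Units.val_mul, ← Units.val_mul] at h'
    rw [Units.ext h', mul_assoc, mul_inv_cancel, mul_one]

theorem numDoubleCosets_eq_lift {S : Type} (f : S → GL (Fin n) A)
    (hf : Function.Bijective fun s => coset (f s)) :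
    numDoubleCosets n A = Cardinal.lift.{u} (Cardinal.mk S) := by
  rw [numDoubleCosets, ← Cardinal.mk_uLift]
  exact (Cardinal.mk_congr (Equiv.ulift.trans (Equiv.ofBijective _ hf))).symm

theorem numDoubleCosets_lt_aleph0 [Finite A] : numDoubleCosets n A < Cardinal.aleph0 := by
  rw [numDoubleCosets, Cardinal.lt_aleph0_iff_finite]
  exact Finite.of_surjective (coset : GL (Fin n) A → _) coset_surjective

theorem numDoubleCosets_of_le_one (hn : n ≤ 1) : numDoubleCosets n A = 1 := by
  have := numDoubleCosets_eq_lift (n := n) (A := A) (S := Unit) (fun _ => 1) ?_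
  · simpa using this
  · refine ⟨fun _ _ _ => rfl, fun q => ?_⟩
    obtain ⟨g, rfl⟩ := coset_surjective q
    have : Subsingleton (Fin n) := Fin.subsingleton_iff_le_one.2 hn
    refine ⟨(), (coset_eq_iff _ _).2 ⟨g, 1, (isUpper_iff_exists _).2
      ⟨g, fun i j h => absurd h (by simp [Subsingleton.elim i j]), rfl⟩, isUpper_one, by simp⟩⟩

end Cosets

/-! ### Powers of the maximal ideal and length -/

section Length

variable {A : Type u} [CommRing A] [IsLocalRing A]

theorem maximalIdeal_pow_eq_bot_iff (m : ℕ) :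
    maximalIdeal A ^ m = ⊥ ↔ ringLength A ≤ m := by
  constructor
  · exact fun h => iInf₂_le m h
  · contrapose!
    intro h
    have : ((m + 1 : ℕ) : ℕ∞) ≤ ringLength A := by
      refine le_iInf₂ fun j hj => ?_
      rw [Nat.cast_le, Nat.succ_le_iff]
      by_contra! hlt
      exact h (le_bot_iff.1 (hj ▸ Ideal.pow_le_pow_right hlt))
    exact lt_of_lt_of_le (by exact_mod_cast m.lt_succ_self) this

theorem ringLength_eq_iff (k : ℕ∞) :
    ringLength A = k ↔ ∀ m : ℕ, maximalIdeal A ^ m = ⊥ ↔ k ≤ m := by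
  simp_rw [maximalIdeal_pow_eq_bot_iff]
  constructor
  · rintro rfl m
    rfl
  · intro h
    refine le_antisymm ?_ ?_
    · cases k with
      | top => exact le_top
      | coe k => exact (h k).2 le_rfl
    · generalize ringLength A = x at h
      cases x with
      | top => exact le_top
      | coe x => exact (h x).1 le_rfl

theorem exists_generator [IsPrincipalIdealRing A] :
    ∃ t : A, maximalIdeal A = Ideal.span {t} :=
  ⟨_, (Submodule.IsPrincipal.span_singleton_generator _).symm⟩

/-- A nonzero element, even a zero divisor, may be cancelled modulo the maximal ideal: were `x - y`
a unit, `s` would vanish. -/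
theorem residue_eq_of_mul_eq_mul {s x y : A} (hs : s ≠ 0) (h : s * x = s * y) :
    residue A x = residue A y := by
  rw [← sub_eq_zero, ← map_sub, residue_eq_zero_iff, mem_maximalIdeal, mem_nonunits_iff]
  intro hu
  exact hs ((hu.mul_left_eq_zero).1 (by rw [mul_sub, h, sub_self]))

end Length

/-! ### Families of cosets parametrized by the residue field -/

section LowerBounds

variable {A : Type u} [CommRing A]

theorem coe_generalLinearGroup_mk {n : ℕ} (M : Matrix (Fin n) (Fin n) A) (h : IsUnit M.det) :
    ((Matrix.GeneralLinearGroup.mk'' M h : GL (Fin n) A) : Matrix (Fin n) (Fin n) A) = M := rfl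

theorem isUpper_toBlocks {m d : ℕ} {M : Matrix (Fin (m + d)) (Fin (m + d)) A} (hM : IsUpper M) :
    IsUpper (M.submatrix finSumFinEquiv finSumFinEquiv).toBlocks₁₁ ∧
      (M.submatrix finSumFinEquiv finSumFinEquiv).toBlocks₂₁ = 0 := by
  refine ⟨⟨fun i j h => hM.1 _ _ (Fin.lt_def.2 (Fin.lt_def.1 h)), fun i => hM.2 _⟩, ?_⟩
  ext i j
  refine hM.1 _ _ ?_
  simp only [finSumFinEquiv_apply_left, finSumFinEquiv_apply_right, Fin.lt_def,
    Fin.val_castAdd, Fin.val_natAdd]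
  omega

/-- The block diagonal matrix with blocks `g` and the identity. -/
noncomputable def blockGL {m : ℕ} (d : ℕ) (g : GL (Fin m) A) : GL (Fin (m + d)) A :=
  Matrix.GeneralLinearGroup.mk'' ((Matrix.fromBlocks (g : Matrix (Fin m) (Fin m) A) 0 0
      (1 : Matrix (Fin d) (Fin d) A)).submatrix finSumFinEquiv.symm finSumFinEquiv.symm) (by
    rw [Matrix.det_submatrix_equiv_self, Matrix.det_fromBlocks_zero₂₁, Matrix.det_one, mul_one]
    exact (Matrix.isUnit_iff_isUnit_det _).1 g.isUnit)

/-- The upper left block of the equation `P g = h Q` is an equation of the same kind, since the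
other blocks of `P` and `Q` meet only zero blocks there. -/
theorem coset_eq_of_coset_blockGL_eq {m d : ℕ} {g h : GL (Fin m) A}
    (H : coset (blockGL d g) = coset (blockGL d h)) : coset g = coset h := by
  obtain ⟨P, Q, hP, hQ, e⟩ := (coset_eq_iff _ _).1 H
  refine (coset_eq_iff _ _).2 ⟨_, _, (isUpper_toBlocks hP).1, (isUpper_toBlocks hQ).1, ?_⟩
  have e' := congrArg (fun M : Matrix (Fin (m + d)) (Fin (m + d)) A =>
    (M.submatrix finSumFinEquiv finSumFinEquiv).toBlocks₁₁) e
  have hb : ∀ g : GL (Fin m) A, ((blockGL d g : GL (Fin (m + d)) A) : Matrix _ _ A).submatrix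
      finSumFinEquiv finSumFinEquiv = Matrix.fromBlocks (g : Matrix (Fin m) (Fin m) A) 0 0
      (1 : Matrix (Fin d) (Fin d) A) := by
    intro g
    simp [blockGL]
  have hp := Matrix.fromBlocks_toBlocks (P.submatrix finSumFinEquiv finSumFinEquiv)
  have hq := Matrix.fromBlocks_toBlocks (Q.submatrix finSumFinEquiv finSumFinEquiv)
  simp only [← Matrix.submatrix_mul_equiv _ _ _ (finSumFinEquiv (m := m) (n := d)) _, hb] at e'
  rw [← hp, ← hq, Matrix.fromBlocks_multiply, Matrix.fromBlocks_multiply] at e'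
  simpa using e'

theorem numDoubleCosets_le_add (m d : ℕ) :
    numDoubleCosets m A ≤ numDoubleCosets (m + d) A := by
  choose r hr using coset_surjective (n := m) (A := A)
  refine Cardinal.mk_le_of_injective (f := fun q => coset (blockGL d (r q))) fun q q' h => ?_
  rw [← hr q, ← hr q', coset_eq_of_coset_blockGL_eq h]

/-- A lower unitriangular matrix of size three. -/
noncomputable def lowerThree (x y z : A) : GL (Fin 3) A :=
  Matrix.GeneralLinearGroup.mk'' !![1, 0, 0; x, 1, 0; z, y, 1] (by simp [Matrix.det_fin_three])

theorem coset_lowerThree_eq {x y z x' y' z' : A}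
    (h : coset (lowerThree x y z) = coset (lowerThree x' y' z')) :
    ∃ P Q : Matrix (Fin 3) (Fin 3) A, IsUpper P ∧ IsUpper Q ∧
      P 2 2 * z = z' * Q 0 0 ∧ P 1 1 * x + P 1 2 * z = x' * Q 0 0 ∧
      P 2 2 * y = z' * Q 0 1 + y' * Q 1 1 ∧ P 1 1 + P 1 2 * y = x' * Q 0 1 + Q 1 1 := by
  obtain ⟨P, Q, hP, hQ, e⟩ := (coset_eq_iff _ _).1 h
  have h20 := congrFun (congrFun e 2) 0
  have h10 := congrFun (congrFun e 1) 0
  have h21 := congrFun (congrFun e 2) 1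
  have h11 := congrFun (congrFun e 1) 1
  have hp := hP.1
  have hq := hQ.1
  simp [lowerThree, Matrix.mul_apply, Fin.sum_univ_three,
    hp 2 0, hp 2 1, hp 1 0, hq 2 0, hq 2 1, hq 1 0] at h20 h10 h21 h11
  exact ⟨P, Q, hP, hQ, h20, h10, h21, h11⟩

variable [IsLocalRing A]

theorem mk_residueField_le {n : ℕ} (f : A → GL (Fin n) A)
    (hf : ∀ x y, coset (f x) = coset (f y) → residue A x = residue A y) :
    Cardinal.mk (ResidueField A) ≤ numDoubleCosets n A := by
  choose r hr using residue_surjective (R := A)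
  refine Cardinal.mk_le_of_injective (f := fun q => coset (f (r q))) fun q q' h => ?_
  rw [← hr q, ← hr q', hf _ _ h]

/-- For entries `t, t, t²e` the equations force `P 1 1 ≡ Q 0 0`, `P 2 2 ≡ Q 1 1` and `P 1 1 ≡ Q 1 1`
modulo the maximal ideal, so the corner entry gives equal residues of `e`. Cancelling `t²` there is
where `t² ≠ 0` enters. -/
theorem mk_residueField_le_three {t : A} (ht : t ∈ maximalIdeal A) (ht2 : t * t ≠ 0) :
    Cardinal.mk (ResidueField A) ≤ numDoubleCosets 3 A := by
  have ht1 : t ≠ 0 := left_ne_zero_of_mul ht2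
  refine mk_residueField_le (fun e => lowerThree t t (t * t * e)) fun x y h => ?_
  obtain ⟨P, Q, hP, hQ, h20, h10, h21, h11⟩ := coset_lowerThree_eq h
  have r0 : residue A t = 0 := (residue_eq_zero_iff t).2 ht
  have e20 := residue_eq_of_mul_eq_mul (x := P 2 2 * x) (y := y * Q 0 0) ht2
    (by linear_combination h20)
  have e10 := residue_eq_of_mul_eq_mul (x := P 1 1 + P 1 2 * t * x) (y := Q 0 0) ht1
    (by linear_combination h10)
  have e21 := residue_eq_of_mul_eq_mul (x := P 2 2) (y := t * y * Q 0 1 + Q 1 1) ht1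
    (by linear_combination h21)
  have e11 := congrArg (residue A) h11
  simp only [map_mul, map_add, r0, mul_zero, zero_mul, add_zero, zero_add] at e20 e10 e21 e11
  have hu := ((hQ.2 0).map (residue A)).ne_zero
  refine mul_right_cancel₀ hu ?_
  linear_combination e20 - residue A x * e21 + residue A x * (e11 - e10)

/-- The matrix with blocks `J`, `0`, `t M`, `J`, where `J` is antidiagonal and `M` has entries
`1, 1, 1, e`. -/
noncomputable def crossFour (t e : A) : GL (Fin 4) A :=
  Matrix.GeneralLinearGroup.mk'' !![0, 1, 0, 0; 1, 0, 0, 0; t, t, 0, 1; t, t * e, 1, 0] (by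
    simp [Matrix.det_succ_row_zero, Fin.sum_univ_succ, Fin.succAbove])

/-- The antidiagonal blocks force `Q 0 1` and `P 2 3` to vanish modulo the maximal ideal. The 2×2
blocks acting on the two sides of `M` are therefore diagonal there, and diagonal scaling preserves
the cross-ratio `e`. -/
theorem mk_residueField_le_four {t : A} (ht : t ∈ maximalIdeal A) (ht1 : t ≠ 0) :
    Cardinal.mk (ResidueField A) ≤ numDoubleCosets 4 A := by
  refine mk_residueField_le (crossFour t) fun x y h => ?_
  obtain ⟨P, Q, hP, hQ, e⟩ := (coset_eq_iff _ _).1 h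
  have r0 : residue A t = 0 := (residue_eq_zero_iff t).2 ht
  have hp := hP.1
  have hq := hQ.1
  have h (i j : Fin 4) := congrFun (congrFun e i) j
  simp only [crossFour, coe_generalLinearGroup_mk, Matrix.mul_apply, Fin.sum_univ_four]
    at h
  have h11 := h 1 1
  have h22 := h 2 2
  have h20 := h 2 0
  have h21 := h 2 1
  have h30 := h 3 0
  have h31 := h 3 1
  simp [hp 1 0, hp 2 0, hp 2 1, hp 3 0, hp 3 1, hp 3 2, hq 1 0, hq 2 0, hq 2 1, hq 3 0, hq 3 1,
    hq 3 2] at h11 h22 h20 h21 h30 h31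
  have e20 := residue_eq_of_mul_eq_mul (x := P 2 2 + P 2 3) (y := Q 0 0) ht1
    (by linear_combination h20)
  have e21 := residue_eq_of_mul_eq_mul (x := P 2 2 + P 2 3 * x) (y := Q 0 1 + Q 1 1) ht1
    (by linear_combination h21)
  have e30 := residue_eq_of_mul_eq_mul (x := P 3 3) (y := Q 0 0) ht1
    (by linear_combination h30)
  have e31 := residue_eq_of_mul_eq_mul (x := P 3 3 * x) (y := Q 0 1 + y * Q 1 1) ht1
    (by linear_combination h31)
  have e11 := congrArg (residue A) h11
  have e22 := congrArg (residue A) h22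
  simp only [map_mul, map_add, r0, mul_zero, zero_mul, add_zero] at e20 e21 e30 e31 e11 e22
  simp only [← e11, e22, zero_mul, add_zero, zero_add] at e20 e21 e31
  refine mul_right_cancel₀ ((hQ.2 1).map (residue A)).ne_zero ?_
  rw [← e31, ← e21, e20, e30, mul_comm]

end LowerBounds

/-! ### Rings of prescribed length with large residue field -/

section Examples

theorem ringLength_eq_top_of_maximalIdeal_ne_bot (R : Type u) [CommRing R] [IsDomain R] [IsLocalRing R]
    (h : maximalIdeal R ≠ ⊥) : ringLength R = ⊤ := by
  rw [ringLength_eq_iff]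
  intro m
  simpa using pow_ne_zero m h

theorem ringLength_quotient {R S : Type u} [CommRing R] [IsDomain R] [IsLocalRing R]
    [IsPrincipalIdealRing R] [CommRing S] [IsLocalRing S] (h : maximalIdeal R ≠ ⊥) (f : R →+* S)
    (hf : Function.Surjective f) {k : ℕ} (hk : RingHom.ker f = maximalIdeal R ^ k) :
    ringLength S = k := by
  rw [ringLength_eq_iff]
  intro m
  have : (maximalIdeal R).map f = maximalIdeal S := map_maximalIdeal_of_surjective f hf
  rw [← this, ← Ideal.map_pow, Ideal.map_eq_bot_iff_le_ker, hk, Nat.cast_le]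
  refine ⟨fun hle => ?_, fun hle => Ideal.pow_le_pow_right hle⟩
  by_contra! hlt
  have := (Ideal.pow_right_strictAnti _ h (maximalIdeal.isMaximal R).ne_top) hlt
  exact absurd hle this.not_ge

/-- For finite `k` a prime field of size above `c` serves; for `k = ⊤` any infinite set carries a
field structure. -/
theorem exists_field_card_lt (k : ℕ∞) (c : Cardinal.{u}) (hc : k ≠ ⊤ → c < Cardinal.aleph0) :
    ∃ (F : Type u) (_ : Field F), c < Cardinal.mk F ∧ (k ≠ ⊤ → Finite F) := by
  by_cases hk : k = ⊤
  · have : Infinite (max (Order.succ c) Cardinal.aleph0).out := by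
      rw [Cardinal.infinite_iff, Cardinal.mk_out]
      exact le_max_right _ _
    obtain ⟨i⟩ := Infinite.nonempty_field (α := (max (Order.succ c) Cardinal.aleph0).out)
    refine ⟨_, i, ?_, fun h => absurd hk h⟩
    rw [Cardinal.mk_out]
    exact lt_max_of_lt_left (Order.lt_succ c)
  · obtain ⟨m, rfl⟩ := Cardinal.lt_aleph0.1 (hc hk)
    obtain ⟨p, hp, hp'⟩ := Nat.exists_infinite_primes (m + 1)
    have : Fact p.Prime := ⟨hp'⟩
    refine ⟨ULift (ZMod p), inferInstance, ?_, fun _ => inferInstance⟩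
    rw [Cardinal.mk_uLift, Cardinal.mk_fintype, ZMod.card, Cardinal.lift_natCast, Nat.cast_lt]
    exact hp

/-- The rings are `F⟦X⟧` for infinite length and `F⟦X⟧ / (X)^k` for length `k`. -/
theorem exists_ring_card_residueField_lt (k : ℕ∞) (hk : 1 ≤ k) (c : Cardinal.{u})
    (hc : k ≠ ⊤ → c < Cardinal.aleph0) :
    ∃ (A : Type u) (_ : CommRing A) (_ : IsLocalRing A) (_ : IsPrincipalIdealRing A),
      ringLength A = k ∧ c < Cardinal.mk (ResidueField A) ∧ (k ≠ ⊤ → Finite A) := by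
  obtain ⟨F, _, hF, hfin⟩ := exists_field_card_lt k c hc
  have hm : maximalIdeal (PowerSeries F) ≠ ⊥ := by
    rw [PowerSeries.maximalIdeal_eq_span_X, Ne, Ideal.span_singleton_eq_bot]
    exact PowerSeries.X_ne_zero
  cases k with
  | top =>
    refine ⟨PowerSeries F, inferInstance, inferInstance, inferInstance,
      ringLength_eq_top_of_maximalIdeal_ne_bot _ hm, hF.trans_le ?_, fun h => absurd rfl h⟩
    exact Cardinal.mk_le_of_injective ((residue _).comp (PowerSeries.C (R := F))).injective
  | coe k =>
    have hk0 : k ≠ 0 := by rintro rfl; simp at hk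
    have hne : maximalIdeal (PowerSeries F) ^ k ≠ ⊤ := fun h =>
      (maximalIdeal.isMaximal (PowerSeries F)).ne_top
        (top_le_iff.1 (h ▸ Ideal.pow_le_self hk0))
    have : Nontrivial (PowerSeries F ⧸ maximalIdeal (PowerSeries F) ^ k) :=
      Ideal.Quotient.nontrivial_iff.2 hne
    have hsurj := Ideal.Quotient.mk_surjective (I := maximalIdeal (PowerSeries F) ^ k)
    have : IsLocalRing (PowerSeries F ⧸ maximalIdeal (PowerSeries F) ^ k) :=
      IsLocalRing.of_surjective' _ hsurj
    refine ⟨PowerSeries F ⧸ maximalIdeal (PowerSeries F) ^ k, inferInstance, inferInstance,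
      IsPrincipalIdealRing.of_surjective _ hsurj,
      ringLength_quotient hm _ hsurj (Ideal.mk_ker), hF.trans_le ?_, fun h => ?_⟩
    · exact Cardinal.mk_le_of_injective
        ((residue _).comp ((Ideal.Quotient.mk _).comp (PowerSeries.C (R := F)))).injective
    · have := hfin h
      have : Finite (PowerSeries F ⧸ maximalIdeal (PowerSeries F)) :=
        Finite.of_equiv F (PowerSeries.residueFieldOfPowerSeries (k := F)).symm.toEquiv
      exact Ideal.finite_quotient_pow (IsNoetherian.noetherian _) k

end Examples

/-! ### Dependence on the residue field -/

theorem mk_residueField_le_numDoubleCosets {n : ℕ} {A : Type u} [CommRing A] [IsLocalRing A]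
    [IsPrincipalIdealRing A] (hn : 3 ≤ n) (hk : 2 ≤ ringLength A)
    (h : 4 ≤ n ∨ 3 ≤ ringLength A) : Cardinal.mk (ResidueField A) ≤ numDoubleCosets n A := by
  obtain ⟨t, ht⟩ := exists_generator (A := A)
  have hmem : t ∈ maximalIdeal A := ht ▸ Ideal.mem_span_singleton_self t
  rcases h with h | h
  · obtain ⟨d, rfl⟩ := Nat.exists_eq_add_of_le h
    refine (mk_residueField_le_four hmem ?_).trans (numDoubleCosets_le_add 4 d)
    rintro rfl
    have := (maximalIdeal_pow_eq_bot_iff (A := A) 1).1 (by simp [ht])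
    exact absurd (hk.trans this) (by decide)
  · obtain ⟨d, rfl⟩ := Nat.exists_eq_add_of_le hn
    refine (mk_residueField_le_three hmem ?_).trans (numDoubleCosets_le_add 3 d)
    intro h0
    have := (maximalIdeal_pow_eq_bot_iff (A := A) 2).1
      (by rw [ht, Ideal.span_singleton_pow, pow_two, h0]; simp)
    exact absurd (h.trans this) (by decide)

theorem dependsOnResidueField {n : ℕ} {k : ℕ∞} (hn : 3 ≤ n) (hk : 2 ≤ k) (h : 4 ≤ n ∨ 3 ≤ k) :
    DependsOnResidueField.{u} n k := by
  have hk1 : 1 ≤ k := le_trans (by decide) hk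
  obtain ⟨A, _, _, _, hA, -, hfin⟩ := exists_ring_card_residueField_lt k hk1 (0 : Cardinal.{u})
    fun _ => Cardinal.aleph0_pos
  -- Writing `N` for the coset count and `κ` for the residue field, this choice gives `|κ(A)| ≤ N(A)
  -- < |κ(A')| ≤ N(A')`.
  obtain ⟨A', _, _, _, hA', hc, hfin'⟩ := exists_ring_card_residueField_lt k hk1
    (numDoubleCosets n A) fun h' => by
      have := hfin h'
      exact numDoubleCosets_lt_aleph0
  refine ⟨A, A', inferInstance, inferInstance, inferInstance, inferInstance, inferInstance,
    inferInstance, hA, hA', ?_, fun h' => ⟨?_, ?_⟩, ?_⟩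
  · exact ((mk_residueField_le_numDoubleCosets hn (hA ▸ hk) (hA ▸ h)).trans_lt hc).ne
  · have := hfin h'
    exact Finite.of_surjective _ (residue_surjective (R := A))
  · have := hfin' h'
    exact Finite.of_surjective _ (residue_surjective (R := A'))
  · exact (hc.trans_le (mk_residueField_le_numDoubleCosets hn (hA' ▸ hk) (hA' ▸ h))).ne

/-! ### Size two: cosets and ideals -/

section SizeTwo

variable {A : Type u} [CommRing A]

/-- A lower unitriangular matrix of size two. -/
noncomputable def lowerTwo (x : A) : GL (Fin 2) A :=
  Matrix.GeneralLinearGroup.mk'' !![1, 0; x, 1] (by simp [Matrix.det_fin_two])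

theorem isUpper_two {a b d : A} (ha : IsUnit a) (hd : IsUnit d) : IsUpper !![a, b; 0, d] := by
  refine ⟨fun i j h => ?_, fun i => ?_⟩
  · fin_cases i <;> fin_cases j <;> first | rfl | exact absurd h (by decide)
  · fin_cases i <;> assumption

theorem span_eq_of_coset_lowerTwo_eq {x y : A} (h : coset (lowerTwo x) = coset (lowerTwo y)) :
    Ideal.span {x} = Ideal.span {y} := by
  obtain ⟨P, Q, hP, hQ, e⟩ := (coset_eq_iff _ _).1 h
  have h10 := congrFun (congrFun e 1) 0
  simp [lowerTwo, Matrix.mul_apply, hP.1 1 0, hQ.1 1 0] at h10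
  rw [← Ideal.span_singleton_mul_left_unit (hP.2 1), h10,
    Ideal.span_singleton_mul_right_unit (hQ.2 0)]

theorem coset_lowerTwo_mul (x : A) (u : Aˣ) : coset (lowerTwo x) = coset (lowerTwo (x * u)) := by
  refine (coset_eq_iff _ _).2 ⟨_, _, isUpper_two (b := 0) isUnit_one u.isUnit,
    isUpper_two (b := 0) isUnit_one u.isUnit, ?_⟩
  ext i j
  fin_cases i <;> fin_cases j <;> simp [lowerTwo, mul_comm]

variable [IsLocalRing A]

theorem exists_isUnit_add_mul (a b : A) (h : IsUnit a ∨ IsUnit b) : ∃ s, IsUnit (a + s * b) := by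
  by_cases ha : IsUnit a
  · exact ⟨0, by simpa using ha⟩
  · refine ⟨1, by_contra fun hn => ?_⟩
    have := (maximalIdeal A).sub_mem ((mem_maximalIdeal _).2 hn) ((mem_maximalIdeal _).2 ha)
    rw [one_mul, add_sub_cancel_left, mem_maximalIdeal] at this
    exact this (h.resolve_left ha)

theorem exists_coset_lowerTwo_eq (g : GL (Fin 2) A) : ∃ x, coset g = coset (lowerTwo x) := by
  have hdet := (Matrix.isUnit_iff_isUnit_det _).1 g.isUnit
  rw [Matrix.det_fin_two] at hdet
  set a := (g : Matrix (Fin 2) (Fin 2) A) 0 0 with ha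
  set b := (g : Matrix (Fin 2) (Fin 2) A) 0 1 with hb
  set c := (g : Matrix (Fin 2) (Fin 2) A) 1 0 with hc
  set d := (g : Matrix (Fin 2) (Fin 2) A) 1 1 with hd
  obtain ⟨s, u, hu⟩ := exists_isUnit_add_mul a c (by
    by_contra! h
    exact (mem_maximalIdeal _).1 (sub_mem (Ideal.mul_mem_right _ _ ((mem_maximalIdeal _).2 h.1))
      (Ideal.mul_mem_left _ _ ((mem_maximalIdeal _).2 h.2))) hdet)
  refine ⟨c * ↑u⁻¹, (coset_eq_iff _ _).2 ⟨_, _, isUpper_two (b := s) isUnit_one isUnit_one,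
    isUpper_two (a := (u : A)) (b := b + s * d) u.isUnit (hdet.mul u⁻¹.isUnit), ?_⟩⟩
  have hinv := u.mul_inv
  ext i j
  fin_cases i <;> fin_cases j <;>
    simp [lowerTwo, Matrix.mul_apply, ← ha, ← hb, ← hc, ← hd, hu]
  · linear_combination (-c) * hinv + c * (↑u⁻¹ : A) * hu
  · linear_combination (-d) * hinv + d * (↑u⁻¹ : A) * hu

/-- Here `x = b y` and `y = a x`, so `(1 - a b) x = 0`. In a local ring either `b` or `1 - a b` is a
unit, and in the latter case both elements vanish. -/
theorem associated_of_span_singleton_eq {x y : A} (h : Ideal.span {x} = Ideal.span {y}) :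
    Associated x y := by
  obtain ⟨a, ha⟩ := Ideal.mem_span_singleton'.1 (h ▸ Ideal.mem_span_singleton_self x)
  obtain ⟨b, hb⟩ := Ideal.mem_span_singleton'.1 (h ▸ Ideal.mem_span_singleton_self y)
  by_cases hu : IsUnit b
  · exact ⟨hu.unit, by rw [mul_comm, ← hb]; rfl⟩
  · have h1 : IsUnit (1 - a * b) := by
      by_contra hn
      have := (maximalIdeal A).add_mem ((mem_maximalIdeal _).2 hn)
        (Ideal.mul_mem_left _ a ((mem_maximalIdeal _).2 hu))
      rw [sub_add_cancel] at this
      exact (mem_maximalIdeal _).1 this isUnit_one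
    have hx : x = 0 := h1.mul_right_eq_zero.1 (by linear_combination -ha - a * hb)
    rw [← hb, hx, mul_zero]

/-- By Krull's intersection theorem a nonzero generator lies outside some power of the maximal
ideal; at the last power containing it, its cofactor is a unit. -/
theorem exists_ideal_eq_pow [IsPrincipalIdealRing A] {I : Ideal A} (hI : I ≠ ⊥) :
    ∃ i : ℕ, I = maximalIdeal A ^ i := by
  obtain ⟨t, ht⟩ := exists_generator (A := A)
  obtain ⟨x, rfl⟩ : ∃ x, I = Ideal.span {x} :=
    ⟨_, (Submodule.IsPrincipal.span_singleton_generator _).symm⟩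
  have hx : x ≠ 0 := fun h => hI (by simp [h])
  have hex : ∃ i, x ∉ maximalIdeal A ^ i := by
    by_contra! h
    have := Ideal.iInf_pow_eq_bot_of_isLocalRing _ (maximalIdeal.isMaximal A).ne_top
    exact hx (by rw [← Ideal.mem_bot, ← this]; exact Submodule.mem_iInf _ |>.2 h)
  classical
  have hpos : Nat.find hex ≠ 0 := fun h => by
    have := Nat.find_spec hex
    rw [h] at this
    simp at this
  obtain ⟨i, hi⟩ := Nat.exists_eq_succ_of_ne_zero hpos
  have hxi : x ∈ maximalIdeal A ^ i := not_not.1 (Nat.find_min hex (m := i) (by omega))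
  have hxi' : x ∉ maximalIdeal A ^ (i + 1) := by
    have := Nat.find_spec hex
    rwa [hi] at this
  refine ⟨i, ?_⟩
  rw [ht, Ideal.span_singleton_pow, Ideal.mem_span_singleton'] at hxi
  obtain ⟨v, rfl⟩ := hxi
  rw [ht, Ideal.span_singleton_pow]
  refine Ideal.span_singleton_mul_left_unit (by_contra fun hv => hxi' ?_) _
  rw [pow_succ', ht, Ideal.span_singleton_pow]
  exact Ideal.mul_mem_mul (ht ▸ (mem_maximalIdeal _).2 hv) (Ideal.mem_span_singleton_self _)

/-- By Nakayama, powers can coincide only once they are zero. -/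
theorem pow_maximalIdeal_ne [IsNoetherianRing A] {i j : ℕ} (h : i < j)
    (hi : i < ringLength A) : maximalIdeal A ^ i ≠ maximalIdeal A ^ j := by
  intro he
  have hle : maximalIdeal A ^ i ≤ maximalIdeal A • maximalIdeal A ^ i := by
    rw [smul_eq_mul, ← pow_succ']
    exact he.le.trans (Ideal.pow_le_pow_right h)
  have := Submodule.eq_bot_of_le_smul_of_le_jacobson_bot _ _ (IsNoetherian.noetherian _) hle
    (maximalIdeal_le_jacobson _)
  exact absurd hi ((maximalIdeal_pow_eq_bot_iff i).1 this).not_gt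

/-- The ideal of a local principal ideal ring with the given exponent; `0` for the exponent `⊤`. -/
noncomputable def idealOfExponent (A : Type u) [CommRing A] [IsLocalRing A] (i : ℕ∞) : Ideal A :=
  i.recTopCoe ⊥ fun i => maximalIdeal A ^ i

/-- The ideal of the lower left entry is a complete invariant. The exponent `⊤` stands for the zero
ideal, so the index set depends on the length alone. -/
theorem numDoubleCosets_two [IsPrincipalIdealRing A] :
    numDoubleCosets 2 A =
      Cardinal.lift.{u} (Cardinal.mk {i : ℕ∞ // i < ringLength A ∨ i = ⊤}) := by
  have hgen (I : Ideal A) : ∃ x, Ideal.span {x} = I :=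
    ⟨_, Submodule.IsPrincipal.span_singleton_generator I⟩
  choose r hr using hgen
  refine numDoubleCosets_eq_lift
    (fun i : {i : ℕ∞ // i < ringLength A ∨ i = ⊤} => lowerTwo (r (idealOfExponent A i.1)))
    ⟨fun ⟨i, hi⟩ ⟨j, hj⟩ h => ?_, fun q => ?_⟩
  · have h' := span_eq_of_coset_lowerTwo_eq h
    rw [hr, hr] at h'
    rw [Subtype.mk_eq_mk]
    cases i with
    | top =>
      cases j with
      | top => rfl
      | coe j =>
        exact absurd (hj.resolve_right (ENat.natCast_ne_top j))
          ((maximalIdeal_pow_eq_bot_iff j).1 h'.symm).not_gt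
    | coe i =>
      have hi := hi.resolve_right (ENat.natCast_ne_top i)
      cases j with
      | top => exact absurd hi ((maximalIdeal_pow_eq_bot_iff i).1 h').not_gt
      | coe j =>
        have hj := hj.resolve_right (ENat.natCast_ne_top j)
        rcases lt_trichotomy i j with hij | hij | hij
        · exact absurd h' (pow_maximalIdeal_ne hij hi)
        · rw [hij]
        · exact absurd h'.symm (pow_maximalIdeal_ne hij hj)
  · obtain ⟨g, rfl⟩ := coset_surjective q
    obtain ⟨x, hx⟩ := exists_coset_lowerTwo_eq g
    have key : ∃ i : {i : ℕ∞ // i < ringLength A ∨ i = ⊤},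
        idealOfExponent A i.1 = Ideal.span {x} := by
      by_cases h0 : Ideal.span {x} = ⊥
      · exact ⟨⟨⊤, Or.inr rfl⟩, h0.symm⟩
      · obtain ⟨i, hi⟩ := exists_ideal_eq_pow h0
        refine ⟨⟨i, Or.inl ?_⟩, hi.symm⟩
        by_contra! h
        exact h0 (hi.trans ((maximalIdeal_pow_eq_bot_iff i).2 h))
    obtain ⟨i, hi⟩ := key
    refine ⟨i, ?_⟩
    have : Ideal.span {x} = Ideal.span {r (idealOfExponent A i.1)} := by rw [hr, hi]
    obtain ⟨u, hu⟩ := associated_of_span_singleton_eq this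
    rw [hx, coset_lowerTwo_mul x u, hu]

end SizeTwo
-- Fields: Bruhat decomposition
section Bruhat

variable {n : ℕ} {F : Type u} [Field F]

/-- The permutation matrix with ones at the places `(σ c, c)`. -/
noncomputable def permGL (F : Type u) [Field F] (σ : Equiv.Perm (Fin n)) : GL (Fin n) F :=
  Matrix.GeneralLinearGroup.mk'' (Matrix.of fun a c => if a = σ c then 1 else 0) (by
    have : (Matrix.of fun a c => if a = σ c then (1 : F) else 0) = (σ⁻¹).permMatrix F := by
      ext a c
      simp [Equiv.Perm.permMatrix, PEquiv.toMatrix_apply, Equiv.Perm.inv_def,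
        Equiv.symm_apply_eq]
    rw [this, Matrix.det_permutation]
    exact (Equiv.Perm.sign σ⁻¹).isUnit.map (Int.castRingHom F))

/-- The entry at `(σ c, c)` equates a nonzero diagonal entry of `P` with `Q (τ⁻¹ σ c) c`, so `τ⁻¹ σ
c ≤ c` for all `c`. A permutation with this property is the identity, as summing over `c` shows. -/
theorem coset_permGL_injective :
    Function.Injective fun σ : Equiv.Perm (Fin n) => coset (permGL F σ) := by
  intro σ τ h
  obtain ⟨P, Q, hP, hQ, e⟩ := (coset_eq_iff _ _).1 h
  have hle (c : Fin n) : τ.symm (σ c) ≤ c := by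
    by_contra! hlt
    have h1 := congrFun (congrFun e (σ c)) c
    simp only [permGL, coe_generalLinearGroup_mk, Matrix.mul_apply, Matrix.of_apply, mul_ite,
      mul_one, mul_zero, Finset.sum_ite_eq', Finset.mem_univ, if_true, ite_mul, one_mul,
      zero_mul] at h1
    have h2 : ∀ x, (σ c = τ x) ↔ (x = τ.symm (σ c)) := fun x => by
      rw [Equiv.eq_symm_apply, eq_comm]
    simp only [h2, Finset.sum_ite_eq', Finset.mem_univ, if_true] at h1
    rw [hQ.1 _ _ hlt] at h1
    exact (hP.2 _).ne_zero h1
  have hsum : ∑ c, ((τ.symm (σ c) : Fin n) : ℕ) = ∑ c : Fin n, (c : ℕ) :=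
    Equiv.sum_comp (σ.trans τ.symm) fun c => (c : ℕ)
  have := (Finset.sum_eq_sum_iff_of_le fun c _ => Fin.le_def.1 (hle c)).1 hsum
  refine Equiv.ext fun c => (Equiv.symm_apply_eq τ).1 (Fin.ext (this c (Finset.mem_univ c)))

theorem coset_eq_of_mul_eq {g h : GL (Fin n) F} {P Q : Matrix (Fin n) (Fin n) F}
    (hP : IsUpper P) (hQ : IsUpper Q)
    (e : (h : Matrix (Fin n) (Fin n) F) = P * (g : Matrix (Fin n) (Fin n) F) * Q) :
    coset g = coset h := by
  obtain ⟨b, hb, rfl⟩ := (isUpper_iff_exists _).1 hP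
  obtain ⟨b', hb', rfl⟩ := (isUpper_iff_exists _).1 hQ
  rw [DoubleCoset.eq]
  exact ⟨b, hb, b', hb', Units.ext e⟩

theorem exists_ne_zero_of_GL (g : GL (Fin n) F) (c : Fin n) :
    ∃ a, (g : Matrix (Fin n) (Fin n) F) a c ≠ 0 := by
  by_contra! h
  exact (((Matrix.isUnit_iff_isUnit_det _).1 g.isUnit).ne_zero)
    (Matrix.det_eq_zero_of_column_eq_zero c h)

theorem injOn_of_column_eq (g : GL (Fin n) F) {p : Fin n → Fin n} {s : Set (Fin n)}
    (hp : ∀ c ∈ s, ∀ a, (g : Matrix (Fin n) (Fin n) F) a c = if a = p c then 1 else 0) :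
    Set.InjOn p s := by
  intro c hc d hd h
  by_contra hne
  refine (((Matrix.isUnit_iff_isUnit_det _).1 g.isUnit).ne_zero)
    (Matrix.det_zero_of_column_eq hne fun a => ?_)
  rw [hp c hc, hp d hd, h]

/-- Gaussian elimination column by column. Taking the lowest nonzero entry as pivot means only
entries above it need clearing, which upper triangular row operations can do. -/
theorem exists_coset_column_eq (g : GL (Fin n) F) (j : ℕ) (hj : j ≤ n) :
    ∃ (h : GL (Fin n) F) (p : Fin n → Fin n), coset g = coset h ∧ ∀ c : Fin n, (c : ℕ) < j →
      ∀ a, (h : Matrix (Fin n) (Fin n) F) a c = if a = p c then 1 else 0 := by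
  induction j with
  | zero => exact ⟨g, id, rfl, fun c hc => absurd hc (Nat.not_lt_zero _)⟩
  | succ j ih =>
    obtain ⟨h, p, hgh, hp⟩ := ih (Nat.le_of_succ_le hj)
    obtain ⟨c₀, hc₀⟩ : ∃ c₀ : Fin n, (c₀ : ℕ) = j := ⟨⟨j, hj⟩, rfl⟩
    have hinj := injOn_of_column_eq h (s := {c | (c : ℕ) < j}) hp
    -- clear the pivot rows of column `c₀`
    obtain ⟨h₁, hh₁, hp₁, hz₁⟩ : ∃ h₁ : GL (Fin n) F, coset h = coset h₁ ∧
        (∀ c : Fin n, (c : ℕ) < j →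
          ∀ a, (h₁ : Matrix (Fin n) (Fin n) F) a c = if a = p c then 1 else 0) ∧
        ∀ c : Fin n, (c : ℕ) < j → (h₁ : Matrix (Fin n) (Fin n) F) (p c) c₀ = 0 := by
      set Q : Matrix (Fin n) (Fin n) F := (1 : Matrix (Fin n) (Fin n) F).updateCol c₀
        (fun c => if (c : ℕ) < j then -(h : Matrix (Fin n) (Fin n) F) (p c) c₀
          else if c = c₀ then 1 else 0) with hQdef
      have hQ : IsUpper Q := by
        refine ⟨fun a b hab => ?_, fun a => ?_⟩
        · rw [hQdef, Matrix.updateCol_apply]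
          split_ifs with h1 h2 h3
          · subst h1; rw [Fin.lt_def] at hab; omega
          · subst h1; exact absurd h3 hab.ne'
          · rfl
          · exact Matrix.one_apply_ne hab.ne'
        · rw [hQdef, Matrix.updateCol_apply]
          split_ifs with h1 h2
          · subst h1; omega
          · exact isUnit_one
          · simp
      obtain ⟨b, hb, hbQ⟩ := (isUpper_iff_exists _).1 hQ
      have hcol (a c : Fin n) (hc : c ≠ c₀) : ((h * b : GL (Fin n) F) :
          Matrix (Fin n) (Fin n) F) a c = (h : Matrix (Fin n) (Fin n) F) a c := by
        rw [Units.val_mul, hbQ, hQdef, Matrix.mul_apply]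
        simp [hc, Matrix.one_apply]
      refine ⟨h * b, coset_eq_of_mul_eq isUpper_one hQ (by simp [hbQ]), fun c hc a => ?_,
        fun c hc => ?_⟩
      · rw [hcol a c (by rintro rfl; omega), hp c hc]
      · rw [Units.val_mul, hbQ, hQdef, Matrix.mul_apply]
        simp only [Matrix.updateCol_self]
        rw [← Finset.add_sum_erase _ _ (Finset.mem_univ c₀),
          ← Finset.add_sum_erase (Finset.univ.erase c₀) _ (a := c) (by
            simp only [Finset.mem_erase, Finset.mem_univ, and_true]; rintro rfl; omega)]
        rw [Finset.sum_eq_zero]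
        · simp [hc, hc₀, hp c hc]
        · intro d hd
          simp only [Finset.mem_erase, Finset.mem_univ, and_true] at hd
          split_ifs with h1 h2
          · rw [hp d h1, if_neg (fun h => hd.1 (hinj h1 hc h.symm)), zero_mul]
          · exact absurd h2 hd.2
          · rw [mul_zero]
    -- normalize the lowest nonzero entry of column `c₀` and clear the entries above it
    obtain ⟨i, hi, hmax⟩ : ∃ i, (h₁ : Matrix (Fin n) (Fin n) F) i c₀ ≠ 0 ∧
        ∀ a, i < a → (h₁ : Matrix (Fin n) (Fin n) F) a c₀ = 0 := by
      obtain ⟨i, hi, hmax⟩ := (Set.toFinite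
        {a | (h₁ : Matrix (Fin n) (Fin n) F) a c₀ ≠ 0}).exists_maximal (exists_ne_zero_of_GL h₁ c₀)
      exact ⟨i, hi, fun a ha => by_contra fun hne => absurd (hmax hne ha.le) ha.not_ge⟩
    set v := (h₁ : Matrix (Fin n) (Fin n) F) i c₀ with hv
    set P : Matrix (Fin n) (Fin n) F := (1 : Matrix (Fin n) (Fin n) F).updateCol i
      (fun a => if a = i then v⁻¹ else -(h₁ : Matrix (Fin n) (Fin n) F) a c₀ / v) with hPdef
    have hP : IsUpper P := by
      refine ⟨fun a b hab => ?_, fun a => ?_⟩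
      · rw [hPdef, Matrix.updateCol_apply]
        split_ifs with h1 h2
        · exact absurd (h2.trans h1.symm) hab.ne'
        · rw [hmax a (h1 ▸ hab), neg_zero, zero_div]
        · exact Matrix.one_apply_ne hab.ne'
      · rw [hPdef, Matrix.updateCol_apply]
        split_ifs with h1
        · exact (inv_ne_zero hi).isUnit
        · simp
    obtain ⟨b, hb, hbP⟩ := (isUpper_iff_exists _).1 hP
    have hrow (a c : Fin n) : ((b * h₁ : GL (Fin n) F) : Matrix (Fin n) (Fin n) F) a c =
        (if a = i then v⁻¹ * (h₁ : Matrix (Fin n) (Fin n) F) i c else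
          (h₁ : Matrix (Fin n) (Fin n) F) a c -
            (h₁ : Matrix (Fin n) (Fin n) F) a c₀ / v * (h₁ : Matrix (Fin n) (Fin n) F) i c) := by
      rw [Units.val_mul, hbP, hPdef, Matrix.mul_apply,
        ← Finset.add_sum_erase _ _ (Finset.mem_univ i)]
      have : ∑ x ∈ Finset.univ.erase i, ((1 : Matrix (Fin n) (Fin n) F).updateCol i
          (fun a => if a = i then v⁻¹ else -(h₁ : Matrix (Fin n) (Fin n) F) a c₀ / v)) a x *
            (h₁ : Matrix (Fin n) (Fin n) F) x c =
          if a = i then 0 else (h₁ : Matrix (Fin n) (Fin n) F) a c := by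
        rw [Finset.sum_congr rfl (g := fun x => if a = x then
          (h₁ : Matrix (Fin n) (Fin n) F) x c else 0)]
        · simp
        · intro x hx
          rw [Matrix.updateCol_apply, if_neg (Finset.ne_of_mem_erase hx), Matrix.one_apply]
          simp
      rw [this, Matrix.updateCol_self]
      split_ifs <;> ring
    refine ⟨b * h₁, Function.update p c₀ i, ?_, fun c hc a => ?_⟩
    · rw [hgh, hh₁]
      exact coset_eq_of_mul_eq hP isUpper_one (by simp [hbP])
    · rw [hrow]
      rcases Nat.lt_succ_iff_lt_or_eq.1 hc with hc | hc
      · have hcc : c ≠ c₀ := by rintro rfl; omega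
        -- The new pivot row is none of the earlier ones, so the row operation leaves the earlier
        -- columns intact.
        have hic : (h₁ : Matrix (Fin n) (Fin n) F) i c = 0 := by
          rw [hp₁ c hc, if_neg]
          rintro rfl
          exact hi (hz₁ c hc)
        rw [Function.update_of_ne hcc, hic, mul_zero, mul_zero, sub_zero, hp₁ c hc]
        split_ifs with h1 h2 h2 <;> try rfl
        rw [← h1, h2, hp₁ c hc, if_pos rfl] at hic
        exact absurd hic one_ne_zero
      · obtain rfl : c = c₀ := Fin.ext (hc.trans hc₀.symm)
        rw [Function.update_self, ← hv]
        split_ifs with h1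
        · exact inv_mul_cancel₀ hi
        · rw [div_mul_cancel₀ _ hi, sub_self]

theorem numDoubleCosets_field (n : ℕ) (F : Type u) [Field F] :
    numDoubleCosets n F = Cardinal.lift.{u} (Cardinal.mk (Equiv.Perm (Fin n))) := by
  refine numDoubleCosets_eq_lift (permGL F) ⟨coset_permGL_injective, fun q => ?_⟩
  obtain ⟨g, rfl⟩ := coset_surjective q
  obtain ⟨h, p, hgh, hp⟩ := exists_coset_column_eq g n le_rfl
  have hinj : Function.Injective p := Set.injOn_univ.1
    (injOn_of_column_eq h fun c _ => hp c c.2)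
  refine ⟨Equiv.ofBijective p (Finite.injective_iff_bijective.1 hinj), ?_⟩
  rw [hgh]
  refine congrArg coset (Matrix.GeneralLinearGroup.ext fun a c => ?_)
  rw [hp c c.2]
  rfl

theorem numDoubleCosets_of_ringLength_eq_one {A : Type u} [CommRing A] [IsLocalRing A]
    (h : ringLength A = 1) :
    numDoubleCosets n A = Cardinal.lift.{u} (Cardinal.mk (Equiv.Perm (Fin n))) := by
  have := (maximalIdeal_pow_eq_bot_iff (A := A) 1).2 h.le
  rw [pow_one] at this
  let _ := (isField_iff_maximalIdeal_eq.2 this).toField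
  exact numDoubleCosets_field n A

end Bruhat

/-! ### Size three: reduction to lower unitriangular matrices -/

section SizeThree

variable {A : Type u} [CommRing A]

theorem isUpper_three {a b c d e f : A} (ha : IsUnit a) (hd : IsUnit d) (hf : IsUnit f) :
    IsUpper !![a, b, c; 0, d, e; 0, 0, f] := by
  refine ⟨fun i j h => ?_, fun i => ?_⟩
  · fin_cases i <;> fin_cases j <;> first | rfl | exact absurd h (by decide)
  · fin_cases i <;> assumption

theorem coset_lowerThree_mul (x y z : A) (α β : Aˣ) :
    coset (lowerThree x y z) = coset (lowerThree (α * x) (β * y) (α * β * z)) := by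
  refine (coset_eq_iff _ _).2 ⟨!![1, 0, 0; 0, α, 0; 0, 0, α * β], !![1, 0, 0; 0, α, 0; 0, 0, α * β],
    isUpper_three isUnit_one α.isUnit (α * β).isUnit,
    isUpper_three isUnit_one α.isUnit (α * β).isUnit, ?_⟩
  ext i j
  fin_cases i <;> fin_cases j <;> simp [lowerThree]
  ring

/-- Adding `s` times the third row to the second turns the middle entry into `1 + s y`; when this is
a unit, an upper triangular column operation restores unitriangular form. -/
theorem coset_lowerThree_add_row (x y z s : A) (u : Aˣ) (hu : (u : A) = 1 + s * y) :
    coset (lowerThree x y z) = coset (lowerThree (x + s * z) (↑u⁻¹ * y) z) := by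
  refine (coset_eq_iff _ _).2 ⟨!![1, 0, 0; 0, 1, s; 0, 0, 1], !![1, 0, 0; 0, u, s; 0, 0, ↑u⁻¹],
    isUpper_three isUnit_one isUnit_one isUnit_one,
    isUpper_three isUnit_one u.isUnit u⁻¹.isUnit, ?_⟩
  have hinv := u.mul_inv
  ext i j
  fin_cases i <;> fin_cases j <;> simp [lowerThree]
  · exact hu.symm
  · linear_combination (-y) * hinv
  · linear_combination (-1) * hinv + (↑u⁻¹ : A) * hu

theorem coset_lowerThree_add_col (x y z s : A) (u : Aˣ) (hu : (u : A) = 1 + s * x) :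
    coset (lowerThree x y z) = coset (lowerThree (↑u⁻¹ * x) (y + s * z) z) := by
  refine (coset_eq_iff _ _).2 ⟨!![u, -s, 0; 0, ↑u⁻¹, 0; 0, 0, 1], !![1, -s, 0; 0, 1, 0; 0, 0, 1],
    isUpper_three u.isUnit u⁻¹.isUnit isUnit_one,
    isUpper_three isUnit_one isUnit_one isUnit_one, ?_⟩
  have hinv := u.mul_inv
  ext i j
  fin_cases i <;> fin_cases j <;> simp [lowerThree]
  · linear_combination hu
  · linear_combination hinv - (↑u⁻¹ : A) * hu
  · ring

theorem exists_coset_lowerThree_eq [IsLocalRing A] (g : GL (Fin 3) A) :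
    ∃ x y z, coset g = coset (lowerThree x y z) := by
  have hdet := (Matrix.isUnit_iff_isUnit_det _).1 g.isUnit
  rw [Matrix.det_fin_three] at hdet
  generalize hM : (g : Matrix (Fin 3) (Fin 3) A) = M at hdet
  have hone (a b c : A) (h : IsUnit a ∨ IsUnit b ∨ IsUnit c) :
      ∃ s r, IsUnit (a + s * b + r * c) := by
    rcases h with h | h | h
    · exact ⟨0, 0, by simpa using h⟩
    · obtain ⟨s, hs⟩ := exists_isUnit_add_mul a b (Or.inr h)
      exact ⟨s, 0, by simpa using hs⟩
    · obtain ⟨s, hs⟩ := exists_isUnit_add_mul a c (Or.inr h)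
      exact ⟨0, s, by simpa using hs⟩
  obtain ⟨s, r, u, hu⟩ := hone (M 0 0) (M 1 0) (M 2 0) (by
    by_contra! h
    simp only [← mem_nonunits_iff, ← mem_maximalIdeal] at h
    refine (mem_maximalIdeal _).1 ?_ hdet
    obtain ⟨h0, h1, h2⟩ := h
    have := add_mem (add_mem (Ideal.mul_mem_right (M 1 1 * M 2 2 - M 1 2 * M 2 1) _ h0)
      (Ideal.mul_mem_right (M 0 2 * M 2 1 - M 0 1 * M 2 2) _ h1))
      (Ideal.mul_mem_right (M 0 1 * M 1 2 - M 0 2 * M 1 1) _ h2)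
    convert this using 1
    ring)
  -- the first row after the first row operation, and two minors of the matrix so obtained
  set b := M 0 1 + s * M 1 1 + r * M 2 1 with hb
  set c := M 0 2 + s * M 1 2 + r * M 2 2 with hc
  -- Sylvester's identity for the minors bordering the pivot `u`. Since the determinant is a unit,
  -- one of the two minors in the first two columns is a unit, which supplies the second pivot `v`.
  have hplucker : u * (M 0 0 * M 1 1 * M 2 2 - M 0 0 * M 1 2 * M 2 1 - M 0 1 * M 1 0 * M 2 2 +
      M 0 1 * M 1 2 * M 2 0 + M 0 2 * M 1 0 * M 2 1 - M 0 2 * M 1 1 * M 2 0) =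
      (u * M 1 1 - b * M 1 0) * (u * M 2 2 - c * M 2 0) -
      (u * M 2 1 - b * M 2 0) * (u * M 1 2 - c * M 1 0) := by
    rw [hb, hc, hu]
    ring
  obtain ⟨q, v, hv⟩ := exists_isUnit_add_mul (u * M 1 1 - b * M 1 0) (u * M 2 1 - b * M 2 0) (by
    by_contra! h
    exact (mem_maximalIdeal _).1 (sub_mem
      (Ideal.mul_mem_right (u * M 2 2 - c * M 2 0) _ ((mem_maximalIdeal _).2 h.1))
      (Ideal.mul_mem_right (u * M 1 2 - c * M 1 0) _ ((mem_maximalIdeal _).2 h.2)))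
      (hplucker ▸ u.isUnit.mul hdet))
  obtain ⟨w, hw⟩ := hdet
  have hui := u.mul_inv
  have hvi := v.mul_inv
  refine ⟨(M 1 0 + q * M 2 0) * ↑u⁻¹, (u * M 2 1 - b * M 2 0) * ↑v⁻¹, M 2 0 * ↑u⁻¹,
    (coset_eq_iff _ _).2 ⟨!![1, s, r; 0, 1, q; 0, 0, 1],
    !![u, b, c; 0, v * ↑u⁻¹,
      M 1 2 + q * M 2 2 - (M 1 0 + q * M 2 0) * ↑u⁻¹ * c; 0, 0, w * ↑v⁻¹],
    isUpper_three isUnit_one isUnit_one isUnit_one,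
    isUpper_three u.isUnit (v * u⁻¹).isUnit (w * v⁻¹).isUnit, ?_⟩⟩
  rw [hM]
  ext i j
  fin_cases i <;> fin_cases j <;> simp [lowerThree, Matrix.mul_apply, Fin.sum_univ_three]
  · exact hu.symm
  · exact hb.symm
  · exact hc.symm
  · linear_combination (-(M 1 1 + q * M 2 1)) * hui - (↑u⁻¹ : A) * hv
  · linear_combination (-M 2 1) * hui - (u * M 2 1 - b * M 2 0) * (↑u⁻¹ : A) * hvi
  · linear_combination (-M 2 2 + (u * M 2 1 - b * M 2 0) * (↑v⁻¹ : A) * (M 1 2 + q * M 2 2) +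
        w * (↑v⁻¹ : A)) * hui - (↑u⁻¹ : A) * (↑v⁻¹ : A) * (u * hw + hplucker) -
      (↑u⁻¹ : A) * (u * M 2 2 - c * M 2 0) * hvi +
      (↑u⁻¹ : A) * (↑v⁻¹ : A) * (u * M 2 2 - c * M 2 0) * hv

end SizeThree

/-! ### Size three and length two: eighteen cosets -/

section SizeThreeLengthTwo

variable {A : Type u} [CommRing A]

theorem coset_eq_of_mul {x y z x' y' z' : A} (α β : Aˣ) (hx : α * x = x') (hy : β * y = y')
    (hz : α * β * z = z') : coset (lowerThree x y z) = coset (lowerThree x' y' z') := by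
  subst hx hy hz
  exact coset_lowerThree_mul x y z α β

theorem coset_eq_of_add_row {x y z x' y' : A} (s : A) (u : Aˣ) (hu : (u : A) = 1 + s * y)
    (hx : x + s * z = x') (hy : y = u * y') :
    coset (lowerThree x y z) = coset (lowerThree x' y' z) := by
  rw [coset_lowerThree_add_row x y z s u hu, hx, hy, Units.inv_mul_cancel_left]

theorem coset_eq_of_add_col {x y z x' y' : A} (s : A) (u : Aˣ) (hu : (u : A) = 1 + s * x)
    (hx : x = u * x') (hy : y + s * z = y') :
    coset (lowerThree x y z) = coset (lowerThree x' y' z) := by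
  rw [coset_lowerThree_add_col x y z s u hu, hy, hx, Units.inv_mul_cancel_left]

/-- Parameters of representatives of the double cosets of size three over a local principal ideal
ring of length two whose maximal ideal is generated by `t`. -/
def params (t : A) : Fin 18 → A × A × A :=
  ![(0, 0, 1), (1, 1, 1), (1, 1, 1 + t), (1, 1, 0), (1, 1, t), (1, 0, 0), (1, t, 0), (1, t, t),
    (1, 0, t), (0, 1, 0), (t, 1, 0), (t, 1, t), (0, 1, t), (0, 0, t), (0, 0, 0), (t, 0, 0),
    (0, t, 0), (t, t, 0)]

/-- The representative with the given index. -/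
noncomputable def representative (t : A) (i : Fin 18) : GL (Fin 3) A :=
  lowerThree (params t i).1 (params t i).2.1 (params t i).2.2

/-- Four membership conditions that depend only on the double coset. -/
def minorConditions (v : A × A × A) (J : Ideal A) : Fin 4 → Prop :=
  ![v.2.2 ∈ J, v.1 * v.2.1 - v.2.2 ∈ J, v.1 ∈ J ∧ v.2.2 ∈ J, v.2.1 ∈ J ∧ v.2.2 ∈ J]

/-- The conditions say that `J` contains the minors of maximal size of a lower left block (1×1, 2×2,
2×1 or 1×2, the last two read entrywise). Upper triangular factors act on such blocks by invertible
blocks, so the ideals of these entries or minors are invariant. -/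
theorem minorConditions_of_coset_eq {v w : A × A × A}
    (h : coset (lowerThree v.1 v.2.1 v.2.2) = coset (lowerThree w.1 w.2.1 w.2.2)) (J : Ideal A)
    (k : Fin 4) (hk : minorConditions v J k) : minorConditions w J k := by
  obtain ⟨x, y, z⟩ := v
  obtain ⟨x', y', z'⟩ := w
  obtain ⟨P, Q, hP, hQ, h20, h10, h21, h11⟩ := coset_lowerThree_eq h
  dsimp only at h20 h10 h21 h11
  have cancel {a q : A} (hq : IsUnit q) (h : a * q ∈ J) : a ∈ J :=
    (Ideal.mul_unit_mem_iff_mem J hq).1 h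
  have hz (hz : z ∈ J) : z' ∈ J := cancel (hQ.2 0) (h20 ▸ J.mul_mem_left _ hz)
  fin_cases k
  · exact hz hk
  · have hk : x * y - z ∈ J := hk
    refine cancel ((hQ.2 0).mul (hQ.2 1)) ?_
    have : (x' * y' - z') * (Q 0 0 * Q 1 1) = P 1 1 * P 2 2 * (x * y - z) := by
      linear_combination (-(P 2 2 * y)) * h10 - x' * Q 0 0 * h21 + P 2 2 * z * h11 +
        (x' * Q 0 1 + Q 1 1) * h20
    exact this ▸ J.mul_mem_left _ hk
  · exact ⟨cancel (hQ.2 0) (h10 ▸ J.add_mem (J.mul_mem_left _ hk.1) (J.mul_mem_left _ hk.2)),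
      hz hk.2⟩
  · have hy : y' * Q 1 1 = P 2 2 * y - z' * Q 0 1 := by linear_combination -h21
    refine ⟨cancel (hQ.2 1) (hy ▸ ?_), hz hk.2⟩
    exact J.sub_mem (J.mul_mem_left _ hk.1) (J.mul_mem_right _ (hz hk.2))

/-- The level of a condition: `0` if it fails for the maximal ideal, `2` if it holds for `0`, and
`1` otherwise. -/
def levels : Fin 18 → Fin 4 → Fin 3 :=
  ![![0, 0, 0, 0], ![0, 2, 0, 0], ![0, 1, 0, 0], ![2, 0, 0, 0], ![1, 0, 0, 0], ![2, 2, 0, 2],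
    ![2, 1, 0, 1], ![1, 2, 0, 1], ![1, 1, 0, 1], ![2, 2, 2, 0], ![2, 1, 1, 0], ![1, 2, 1, 0],
    ![1, 1, 1, 0], ![1, 1, 1, 1], ![2, 2, 2, 2], ![2, 2, 1, 2], ![2, 2, 2, 1], ![2, 2, 1, 1]]

theorem levels_injective : Function.Injective levels := by decide

variable [IsLocalRing A]

theorem minorConditions_params {t : A} (ht : t ∈ maximalIdeal A) (ht0 : t ≠ 0) (ht2 : t * t = 0)
    (i : Fin 18) (k : Fin 4) :
    (minorConditions (params t i) ⊥ k ↔ levels i k = 2) ∧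
      (minorConditions (params t i) (maximalIdeal A) k ↔ 1 ≤ levels i k) := by
  have h1 : (1 : A) ∉ maximalIdeal A := (Ideal.ne_top_iff_one _).1 (maximalIdeal.isMaximal A).ne_top
  have h2 : 1 + t ∉ maximalIdeal A := fun h => h1 (by simpa using sub_mem h ht)
  have h3 : 1 - t ∉ maximalIdeal A := fun h => h1 (by simpa using add_mem h ht)
  have h4 : 1 + t ≠ 0 := fun h => h2 (h ▸ zero_mem _)
  have h5 : 1 - t ≠ 0 := fun h => h3 (h ▸ zero_mem _)
  fin_cases k <;> fin_cases i <;>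
    simp [minorConditions, params, levels, -mem_maximalIdeal, ht, ht0, ht2, h1, h2, h3, h4, h5]

theorem representative_injective {t : A} (ht : t ∈ maximalIdeal A) (ht0 : t ≠ 0)
    (ht2 : t * t = 0) : Function.Injective fun i => coset (representative t i) := by
  intro i j h
  refine levels_injective (funext fun k => ?_)
  have key (J : Ideal A) := Iff.intro (minorConditions_of_coset_eq h J k)
    (minorConditions_of_coset_eq h.symm J k)
  have h0 := key ⊥
  have h1 := key (maximalIdeal A)
  rw [(minorConditions_params ht ht0 ht2 i k).1, (minorConditions_params ht ht0 ht2 j k).1] at h0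
  rw [(minorConditions_params ht ht0 ht2 i k).2, (minorConditions_params ht ht0 ht2 j k).2] at h1
  revert h0 h1
  generalize levels i k = a
  generalize levels j k = b
  revert a b
  decide

theorem exists_representative_eq {t : A} (ht : maximalIdeal A = Ideal.span {t}) (ht0 : t ≠ 0)
    (ht2 : t * t = 0) (x y z : A) :
    ∃ i, coset (lowerThree x y z) = coset (representative t i) := by
  -- Since `t² = 0`, every element is a unit, zero, or `t` times a unit; the case analysis below
  -- runs on this trichotomy.
  have tri (a : A) : (∃ u : Aˣ, a = u) ∨ a = 0 ∨ ∃ u : Aˣ, a = t * u := by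
    by_cases ha : IsUnit a
    · exact Or.inl ⟨ha.unit, rfl⟩
    · have : a ∈ Ideal.span {t} := ht ▸ (mem_maximalIdeal a).2 ha
      obtain ⟨b, rfl⟩ := Ideal.mem_span_singleton.1 this
      by_cases hb : IsUnit b
      · exact Or.inr (Or.inr ⟨hb.unit, rfl⟩)
      · have : b ∈ Ideal.span {t} := ht ▸ (mem_maximalIdeal b).2 hb
        obtain ⟨c, rfl⟩ := Ideal.mem_span_singleton.1 this
        exact Or.inr (Or.inl (by rw [← mul_assoc, ht2, zero_mul]))
  have tri' (a : A) : (∃ u : Aˣ, a = u) ∨ ∃ b, a = t * b := by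
    rcases tri a with h | rfl | ⟨u, rfl⟩
    · exact Or.inl h
    · exact Or.inr ⟨0, by simp⟩
    · exact Or.inr ⟨u, rfl⟩
  have hnu (w : Aˣ) (a : A) : (w : A) ≠ t * a := fun h => ht0 (by
    have h' := congrArg (t * ·) h
    simp only [← mul_assoc, ht2, zero_mul] at h'
    exact (Units.mul_left_eq_zero w).1 h')
  have hadd (w : Aˣ) (a : A) : ∃ w' : Aˣ, (w' : A) = w + t * a := by
    rcases tri' (w + t * a) with ⟨u, hu⟩ | ⟨b, hb⟩
    · exact ⟨u, hu.symm⟩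
    · exact absurd (by linear_combination hb) (hnu w (b - a))
  rcases tri z with ⟨w, rfl⟩ | hz
  · rcases tri (x * y - w) with ⟨d, hd⟩ | hd
    -- With `w` and the minor `x y - w` both units, the corner `w` clears `x` by a row operation and
    -- then `y` by a column operation.
    · refine ⟨0, ?_⟩
      rw [coset_eq_of_add_row (x' := 0) (y' := ↑(-d * w⁻¹)⁻¹ * y) (-x * ↑w⁻¹) (-d * w⁻¹) ?_ ?_ ?_,
        coset_eq_of_add_col (x' := 0) (y' := 0) (-(↑(-d * w⁻¹)⁻¹ * y) * ↑w⁻¹) 1 ?_ ?_ ?_,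
        coset_eq_of_mul w⁻¹ 1 rfl rfl rfl]
      · simp [representative, params]
      · simp
      · simp
      · rw [mul_assoc (-(↑(-d * w⁻¹)⁻¹ * y)), Units.inv_mul]; ring
      · push_cast
        linear_combination (↑w⁻¹ : A) * hd + w.mul_inv
      · rw [mul_assoc, Units.inv_mul]; ring
      · rw [Units.mul_inv_cancel_left]
    · have hxy : (∃ a : Aˣ, x = a) ∧ ∃ b : Aˣ, y = b := by
        have hd' : ∃ e, x * y - w = t * e := by
          rcases hd with hd | ⟨u, hd⟩
          · exact ⟨0, by simpa using hd⟩
          · exact ⟨u, hd⟩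
        obtain ⟨e, he⟩ := hd'
        constructor
        · refine (tri' x).resolve_right ?_
          rintro ⟨b, rfl⟩
          exact hnu w (b * y - e) (by linear_combination -he)
        · refine (tri' y).resolve_right ?_
          rintro ⟨b, rfl⟩
          exact hnu w (b * x - e) (by linear_combination -he)
      obtain ⟨⟨a, rfl⟩, b, rfl⟩ := hxy
      rcases hd with hd | ⟨e, he⟩
      · refine ⟨1, coset_eq_of_mul a⁻¹ b⁻¹ (by simp [params]) (by simp [params]) ?_⟩
        rw [← sub_eq_zero.1 hd]
        simp [params, mul_assoc, mul_left_comm]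
      · set v : Aˣ := a⁻¹ * b⁻¹ * e with hv
        have h1 : coset (lowerThree (a : A) b w) = coset (lowerThree 1 1 (1 - t * v)) := by
          refine coset_eq_of_mul a⁻¹ b⁻¹ (by simp) (by simp) ?_
          rw [hv]
          push_cast
          linear_combination (-(↑a⁻¹ : A) * ↑b⁻¹) * he + a.mul_inv + a * ↑a⁻¹ * b.mul_inv
        -- The row operation with `s = -1 - v` makes the middle entry `-v`. After rescaling, the
        -- corner becomes `-v (1 - t v) / r = 1 + t`, so the parameter `v` disappears.
        obtain ⟨r, hr⟩ := hadd (-v) ((1 + v) * v)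
        push_cast at hr
        refine ⟨2, ?_⟩
        rw [h1, coset_eq_of_add_row (x' := (r : A)) (y' := ↑(-v)⁻¹) (-1 - v) (-v) ?_ ?_ ?_]
        · refine coset_eq_of_mul r⁻¹ (-v) (by simp [params]) (by simp [params]) ?_
          have : (1 + t) * r = -v * (1 - t * v) := by
            rw [hr]
            linear_combination (v + v ^ 2 : A) * ht2
          change _ = 1 + t
          push_cast
          linear_combination (-(↑r⁻¹ : A)) * this + (1 + t) * r.mul_inv
        · push_cast
          ring
        · linear_combination -hr
        · simp
  · have hz' : ∃ c, z = t * c := by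
      rcases hz with rfl | ⟨u, rfl⟩
      · exact ⟨0, by simp⟩
      · exact ⟨u, rfl⟩
    rcases tri x with ⟨a, rfl⟩ | hx <;> rcases tri y with ⟨b, rfl⟩ | hy
    · rcases hz with rfl | ⟨c, rfl⟩
      · exact ⟨3, coset_eq_of_mul a⁻¹ b⁻¹ (by simp [params]) (by simp [params])
          (by simp [params])⟩
      · set d : Aˣ := a⁻¹ * b⁻¹ * c with hd
        have h1 : coset (lowerThree (a : A) b (t * c)) = coset (lowerThree 1 1 (t * d)) := by
          refine coset_eq_of_mul a⁻¹ b⁻¹ (by simp) (by simp) ?_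
          rw [hd]
          push_cast
          ring
        -- The choice `s = d⁻¹ - 1` makes the middle entry `d⁻¹`; rescaling then absorbs `d`, since
        -- `r t = t`.
        obtain ⟨r, hr⟩ := hadd 1 ((↑d⁻¹ - 1) * d)
        push_cast at hr
        refine ⟨4, ?_⟩
        rw [h1, coset_eq_of_add_row (x' := (r : A)) (y' := (d : A)) (↑d⁻¹ - 1) d⁻¹ (by ring) ?_ ?_]
        · refine coset_eq_of_mul r⁻¹ d⁻¹ (by simp [params]) (by simp [params]) ?_
          have : r * t = t := by
            rw [hr]
            linear_combination ((↑d⁻¹ - 1) * d : A) * ht2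
          change _ = t
          linear_combination t * (↑r⁻¹ : A) * d.mul_inv - (↑r⁻¹ : A) * this + t * r.mul_inv
        · linear_combination -hr
        · simp
    · have h1 (z : A) : coset (lowerThree (a : A) y z) = coset (lowerThree 1 y (↑a⁻¹ * z)) :=
        coset_eq_of_mul a⁻¹ 1 (by simp) (by simp) (by simp)
      rcases hz with rfl | ⟨c, rfl⟩ <;> rcases hy with rfl | ⟨b, rfl⟩
      · exact ⟨5, coset_eq_of_mul a⁻¹ 1 (by simp [params]) (by simp [params]) (by simp [params])⟩
      · exact ⟨6, coset_eq_of_mul a⁻¹ b⁻¹ (by simp [params])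
          (by simp [params, mul_left_comm]) (by simp [params])⟩
      · exact ⟨8, coset_eq_of_mul a⁻¹ (a * c⁻¹) (by simp [params]) (by simp [params])
          (by simp [params, mul_left_comm])⟩
      · have h1 : coset (lowerThree (a : A) (t * b) (t * c)) =
            coset (lowerThree 1 (t * ↑(a * c⁻¹ * b)) t) :=
          coset_eq_of_mul a⁻¹ (a * c⁻¹) (by simp) (by push_cast; ring)
            (by simp [mul_left_comm])
        rw [h1]
        generalize a * c⁻¹ * b = e
        -- The minor is `t (e - 1)`. If it is nonzero, the column operation with `s = -e` has the
        -- unit multiplier `1 - e` and clears the entry `t e`; otherwise `t e = t`.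
        rcases tri' (e - 1) with ⟨u, hu⟩ | ⟨p, hp⟩
        · refine ⟨8, ?_⟩
          rw [coset_eq_of_add_col (x' := ↑(-u)⁻¹) (y' := 0) (-(e : A)) (-u) ?_ ?_ ?_]
          · exact coset_eq_of_mul (-u) (-u)⁻¹ (by simp [params]) (by simp [params])
              (by simp [params])
          · push_cast
            linear_combination hu
          · simp
          · ring
        · refine ⟨7, coset_eq_of_mul 1 1 (by simp [params]) ?_ (by simp [params])⟩
          change _ = t
          push_cast
          linear_combination t * hp + p * ht2
    · rcases hz with rfl | ⟨c, rfl⟩ <;> rcases hx with rfl | ⟨a, rfl⟩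
      · exact ⟨9, coset_eq_of_mul 1 b⁻¹ (by simp [params]) (by simp [params]) (by simp [params])⟩
      · exact ⟨10, coset_eq_of_mul a⁻¹ b⁻¹ (by simp [params, mul_left_comm])
          (by simp [params]) (by simp [params])⟩
      · exact ⟨12, coset_eq_of_mul (b * c⁻¹) b⁻¹ (by simp [params]) (by simp [params])
          (by simp [params, mul_right_comm _ (↑c⁻¹ : A), mul_left_comm _ t])⟩
      · have h1 : coset (lowerThree (t * a) (b : A) (t * c)) =
            coset (lowerThree (t * ↑(b * c⁻¹ * a)) 1 t) :=
          coset_eq_of_mul (b * c⁻¹) b⁻¹ (by push_cast; ring) (by simp)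
            (by simp [mul_right_comm _ (↑c⁻¹ : A), mul_left_comm _ t])
        rw [h1]
        generalize b * c⁻¹ * a = e
        rcases tri' (e - 1) with ⟨u, hu⟩ | ⟨p, hp⟩
        · refine ⟨12, ?_⟩
          rw [coset_eq_of_add_row (x' := 0) (y' := ↑(-u)⁻¹) (-(e : A)) (-u) ?_ ?_ ?_]
          · exact coset_eq_of_mul (-u)⁻¹ (-u) (by simp [params]) (by simp [params])
              (by simp [params])
          · push_cast
            linear_combination hu
          · ring
          · simp
        · refine ⟨11, coset_eq_of_mul 1 1 ?_ (by simp [params]) (by simp [params])⟩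
          change _ = t
          push_cast
          linear_combination t * hp + p * ht2
    · rcases hz with rfl | ⟨c, rfl⟩
      · rcases hx with rfl | ⟨a, rfl⟩ <;> rcases hy with rfl | ⟨b, rfl⟩
        · exact ⟨14, rfl⟩
        · exact ⟨16, coset_eq_of_mul 1 b⁻¹ (by simp [params]) (by simp [params, mul_left_comm])
            (by simp [params])⟩
        · exact ⟨15, coset_eq_of_mul a⁻¹ 1 (by simp [params, mul_left_comm]) (by simp [params])
            (by simp [params])⟩
        · exact ⟨17, coset_eq_of_mul a⁻¹ b⁻¹ (by simp [params, mul_left_comm])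
            (by simp [params, mul_left_comm]) (by simp [params])⟩
      · obtain ⟨p, rfl⟩ : ∃ p, x = t * p := by
          rcases hx with rfl | ⟨u, rfl⟩
          · exact ⟨0, by simp⟩
          · exact ⟨u, rfl⟩
        obtain ⟨q, rfl⟩ : ∃ q, y = t * q := by
          rcases hy with rfl | ⟨u, rfl⟩
          · exact ⟨0, by simp⟩
          · exact ⟨u, rfl⟩
        obtain ⟨r, hr⟩ := hadd 1 (-p * ↑c⁻¹ * q)
        push_cast at hr
        refine ⟨13, ?_⟩
        rw [coset_eq_of_add_row (x' := 0) (y' := ↑r⁻¹ * (t * q)) (-p * ↑c⁻¹) r ?_ ?_ ?_,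
          coset_eq_of_add_col (x' := 0) (y' := 0) (-(↑r⁻¹ * q) * ↑c⁻¹) 1 ?_ ?_ ?_]
        · exact coset_eq_of_mul c⁻¹ 1 (by simp [params]) (by simp [params])
            (by simp [params, mul_left_comm])
        · simp
        · simp
        · linear_combination (-(t * ↑r⁻¹ * q)) * c.mul_inv
        · linear_combination hr
        · linear_combination (-(t * p)) * c.mul_inv
        · rw [Units.mul_inv_cancel_left]

theorem numDoubleCosets_three_of_ringLength_eq_two [IsPrincipalIdealRing A]
    (h : ringLength A = 2) : numDoubleCosets 3 A = 18 := by
  obtain ⟨t, ht⟩ := exists_generator (A := A)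
  have ht0 : t ≠ 0 := by
    rintro rfl
    have := (maximalIdeal_pow_eq_bot_iff (A := A) 1).1 (by simp [ht])
    rw [h] at this
    exact absurd this (by decide)
  have ht2 : t * t = 0 := by
    have := (maximalIdeal_pow_eq_bot_iff (A := A) 2).2 h.le
    rwa [ht, Ideal.span_singleton_pow, Ideal.span_singleton_eq_bot, pow_two] at this
  have hmem : t ∈ maximalIdeal A := ht ▸ Ideal.mem_span_singleton_self t
  rw [numDoubleCosets_eq_lift (representative t)
    ⟨representative_injective hmem ht0 ht2, fun q => ?_⟩]
  · simp
  · obtain ⟨g, rfl⟩ := coset_surjective q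
    obtain ⟨x, y, z, hg⟩ := exists_coset_lowerThree_eq g
    obtain ⟨i, hi⟩ := exists_representative_eq ht ht0 ht2 x y z
    exact ⟨i, (hg.trans hi).symm⟩

end SizeThreeLengthTwo

/-! ### Independence in the exceptional cases, and the conclusion -/

theorem independent_of {n : ℕ} {k : ℕ∞} (h : n ≤ 2 ∨ k = 1 ∨ n = 3 ∧ k = 2) :
    Independent.{u} n k := by
  intro A A' _ _ _ _ _ _ hA hA'
  rcases h with h | rfl | ⟨rfl, rfl⟩
  · rcases Nat.le_or_eq_of_le_succ h with h | rfl
    · rw [numDoubleCosets_of_le_one h, numDoubleCosets_of_le_one h]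
    · rw [numDoubleCosets_two, numDoubleCosets_two, hA, hA']
  · rw [numDoubleCosets_of_ringLength_eq_one hA, numDoubleCosets_of_ringLength_eq_one hA']
  · rw [numDoubleCosets_three_of_ringLength_eq_two hA,
      numDoubleCosets_three_of_ringLength_eq_two hA']

theorem not_independent_of_dependsOnResidueField {n : ℕ} {k : ℕ∞}
    (h : DependsOnResidueField.{u} n k) : ¬ Independent.{u} n k := by
  obtain ⟨A, A', _, _, _, _, _, _, hA, hA', -, -, hne⟩ := h
  exact fun hi => hne (hi A A' hA hA')

end LocalPIR

theorem mainTheorem1 (n : ℕ) (k : ℕ∞) (hk : 1 ≤ k) :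
    (LocalPIR.Independent.{u} n k ↔ n ≤ 2 ∨ k = 1 ∨ (n = 3 ∧ k = 2)) ∧
    (¬ (n ≤ 2 ∨ k = 1 ∨ (n = 3 ∧ k = 2)) → LocalPIR.DependsOnResidueField.{u} n k) := by
  have hdep (h : ¬ (n ≤ 2 ∨ k = 1 ∨ (n = 3 ∧ k = 2))) :
      LocalPIR.DependsOnResidueField.{u} n k := by
    push Not at h
    obtain ⟨h1, h2, h3⟩ := h
    have hk2 : 2 ≤ k := by
      have := Order.add_one_le_of_lt (lt_of_le_of_ne hk h2.symm)
      rwa [one_add_one_eq_two] at this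
    refine LocalPIR.dependsOnResidueField h1 hk2 ?_
    by_cases hn : n = 3
    · right
      have := Order.add_one_le_of_lt (lt_of_le_of_ne hk2 (h3 hn).symm)
      rwa [two_add_one_eq_three] at this
    · left
      omega
  refine ⟨⟨fun hi => ?_, LocalPIR.independent_of⟩, hdep⟩
  by_contra h
  exact LocalPIR.not_independent_of_dependsOnResidueField (hdep h) hi
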